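/- Let $W=(W_t)_{t\ge 0}$ be a standard three-dimensional Brownian motion with continuous paths, started at the origin, on a probability space with probability measure $\mathbb P$. For $t>0$ and $x\in\mathbb R^3$ let $$\Lambda_t(x)=\frac1t\int_0^t\frac{ds}{|W_s-x|}.$$ Then, for every $b>0$, $$\lim_{\delta\downarrow 0}\ \limsup_{t\to\infty}\ \frac1t\log\mathbb P\Big\{\sup_{x_1,x_2\in\mathbb R^3:\ |x_1-x_2|\le\delta}\big|\Lambda_t(x_1)-\Lambda_t(x_2)\big|\ge b\Big\}=-\infty .$$ -/

import Mathlib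

open MeasureTheory ProbabilityTheory Filter Topology
open scoped NNReal ENNReal

/-- Standard three-dimensional Brownian motion started at the origin: the three coordinate
processes are independent one-dimensional Brownian motions (`IsBrownianReal` includes almost sure
continuity of the paths and, the variance at time `0` being `0`, the almost sure start at `0`). -/
structure IsBrownianMotion3 {Ω : Type*} [MeasurableSpace Ω]
    (W : ℝ≥0 → Ω → EuclideanSpace ℝ (Fin 3)) (P : Measure Ω) : Prop where
  isBrownianReal : ∀ i : Fin 3, IsBrownianReal (fun t ω => W t ω i) P
  iIndepFun : iIndepFun (fun (i : Fin 3) (ω : Ω) (t : ℝ≥0) => W t ω i) P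

/-- `Λ_t(x) = (1/t) ∫₀ᵗ ds / |w_s - x|` for a path `w` in three-dimensional space and `t > 0`, as an
element of `[0, ∞]`, where `1 / 0 = ∞`. -/
noncomputable def coulombFunctional (w : ℝ≥0 → EuclideanSpace ℝ (Fin 3)) (t : ℝ)
    (x : EuclideanSpace ℝ (Fin 3)) : ℝ≥0∞ :=
  (ENNReal.ofReal t)⁻¹ * ∫⁻ s in Set.Icc (0 : ℝ) t, ‖w s.toNNReal - x‖ₑ⁻¹

/-- `sup_{|x₁ - x₂| ≤ δ} |Λ_t(x₁) - Λ_t(x₂)|` in `[0, ∞]`. The difference is taken in the extended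
reals, so its absolute value is the usual one when both terms are finite, and `∞` as soon as one of
them is infinite (also in the case `∞ - ∞`). -/
noncomputable def coulombOscillation (w : ℝ≥0 → EuclideanSpace ℝ (Fin 3)) (t δ : ℝ) : ℝ≥0∞ :=
  ⨆ (x₁ : EuclideanSpace ℝ (Fin 3)) (x₂ : EuclideanSpace ℝ (Fin 3)) (_ : dist x₁ x₂ ≤ δ),
    ((coulombFunctional w t x₁ : EReal) - (coulombFunctional w t x₂ : EReal)).abs

/-! Cut the kernel `1/|y|` at radius `ε`. Outside, it varies by at most `δ / ε ^ 2` under a shift of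
length `δ`; inside, it is dominated by a sum over `k` of indicators of balls of radius `ε / 4 ^ k`
with weights `4 ^ (k + 1) / ε`. The oscillation can therefore reach `b` only if, for some `k`, some
ball of radius `ε / 4 ^ k` is occupied for a time at least of order `b * ε * t / 8 ^ k`
(`coulombOscillation_le`).

Occupying a ball of radius `r` for time `a` costs about `exp (-const * a / r ^ 2)`: by transience
the Green function of such a ball is of order `r ^ 2`, and Khasminskii's lemma turns this into an
exponential moment. At scale `k` the exponent is of order `b * t * 2 ^ k / ε`, so the scales sum,
and the rate `b / ε` is arbitrarily large as `ε` decreases; then `δ` is taken small compared with `b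
* ε ^ 2`.

The supremum over centres in all of space needs no net and no confinement of the path. If `ball c r`
is occupied for time `a`, then every starting point in `ball (-c) r` sends the translated path into
`ball 0 (2 * r)` for that time. So the set of such starting points has volume at least that of a
ball, while its expected volume is an integral over Lebesgue measure, linear in `t`
(`lintegral_measure_visits_le`, `measure_exists_occupation_ge_le`). Exponential moments are computed
for the walk sampled at multiples of `h`, and Fatou's lemma passes to continuous time. -/

/-! ### Independence of increments in three dimensions. -/

/-- A three-dimensional pre-Brownian motion: independent pre-Brownian coordinates. -/
structure IsPreBrownian3 {Ω : Type*} [MeasurableSpace Ω]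
    (U : ℝ≥0 → Ω → Fin 3 → ℝ) (P : Measure Ω) : Prop where
  coord : ∀ i, IsPreBrownianReal (fun t ω => U t ω i) P
  indep : iIndepFun (fun (i : Fin 3) (ω : Ω) (t : ℝ≥0) => U t ω i) P

/-- If the pairs `(X i, Y i)` are independent, and `X i` is independent of `Y i` for each `i`, then
the vectors `X` and `Y` are independent. -/
lemma indepFun_pi_of_iIndepFun_prodMk {ι Ω α β : Type*} [Fintype ι] [MeasurableSpace Ω]
    [MeasurableSpace α] [MeasurableSpace β] {P : Measure Ω} [IsProbabilityMeasure P]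
    {X : ι → Ω → α} {Y : ι → Ω → β}
    (hX : ∀ i, AEMeasurable (X i) P) (hY : ∀ i, AEMeasurable (Y i) P)
    (hXY : iIndepFun (fun i ω => (X i ω, Y i ω)) P) (h : ∀ i, IndepFun (X i) (Y i) P) :
    IndepFun (fun ω i => X i ω) (fun ω i => Y i ω) P := by
  have h1 := hXY.map_fun_eq_pi_map (fun i => (hX i).prodMk (hY i))
  have hX1 : iIndepFun X P := hXY.comp (fun _ => Prod.fst) (fun _ => measurable_fst)
  have hY1 : iIndepFun Y P := hXY.comp (fun _ => Prod.snd) (fun _ => measurable_snd)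
  rw [indepFun_iff_map_prod_eq_prod_map_map (aemeasurable_pi_lambda _ hX)
    (aemeasurable_pi_lambda _ hY), hX1.map_fun_eq_pi_map hX, hY1.map_fun_eq_pi_map hY]
  have : ∀ i, IsProbabilityMeasure (P.map (X i)) := fun i => Measure.isProbabilityMeasure_map (hX i)
  have : ∀ i, IsProbabilityMeasure (P.map (Y i)) := fun i => Measure.isProbabilityMeasure_map (hY i)
  have h2 := (measurePreserving_arrowProdEquivProdArrow α β ι (fun i => P.map (X i))
    (fun i => P.map (Y i))).map_eq
  rw [← h2]
  have h3 : ∀ i, P.map (fun ω => (X i ω, Y i ω)) = (P.map (X i)).prod (P.map (Y i)) :=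
    fun i => (indepFun_iff_map_prod_eq_prod_map_map (hX i) (hY i)).1 (h i)
  simp_rw [h3] at h1
  rw [← h1, AEMeasurable.map_map_of_aemeasurable
    (MeasurableEquiv.measurable _).aemeasurable
    (aemeasurable_pi_lambda _ fun i => (hX i).prodMk (hY i))]
  rfl

/-- Integration of a function of two independent random variables. -/
lemma lintegral_indepFun {Ω α β : Type*} [MeasurableSpace Ω]
    [MeasurableSpace α] [MeasurableSpace β] {P : Measure Ω} [IsProbabilityMeasure P]
    {X : Ω → α} {Y : Ω → β} (hX : AEMeasurable X P) (hY : AEMeasurable Y P)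
    (h : IndepFun X Y P) {Φ : α × β → ℝ≥0∞} (hΦ : Measurable Φ) :
    ∫⁻ ω, Φ (X ω, Y ω) ∂P = ∫⁻ ω, ∫⁻ ω', Φ (X ω, Y ω') ∂P ∂P := by
  have : IsProbabilityMeasure (P.map X) := Measure.isProbabilityMeasure_map hX
  have : IsProbabilityMeasure (P.map Y) := Measure.isProbabilityMeasure_map hY
  rw [← lintegral_map' (f := Φ) (g := fun ω => (X ω, Y ω)) hΦ.aemeasurable (hX.prodMk hY),
    (indepFun_iff_map_prod_eq_prod_map_map hX hY).1 h, lintegral_prod _ hΦ.aemeasurable,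
    lintegral_map' hΦ.lintegral_prod_right'.aemeasurable hX]
  refine lintegral_congr fun ω => ?_
  exact lintegral_map' (hΦ.comp measurable_prodMk_left).aemeasurable hY

namespace IsPreBrownian3

variable {Ω : Type*} [MeasurableSpace Ω] {P : Measure Ω} {U : ℝ≥0 → Ω → Fin 3 → ℝ}

lemma aemeasurable (hU : IsPreBrownian3 U P) (t : ℝ≥0) : AEMeasurable (U t) P :=
  aemeasurable_pi_lambda _ fun i => (hU.coord i).aemeasurable t

lemma shift (hU : IsPreBrownian3 U P) (t₀ : ℝ≥0) :
    IsPreBrownian3 (fun t ω => U (t₀ + t) ω - U t₀ ω) P where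
  coord i := (hU.coord i).shift t₀
  indep := hU.indep.comp (fun _ w t => w (t₀ + t) - w t₀)
    (fun _ => measurable_pi_lambda _ fun t =>
      (measurable_pi_apply (t₀ + t)).sub (measurable_pi_apply t₀))

/-- The value at time `t₀` is independent of the later increments. -/
lemma indepFun_increments [IsProbabilityMeasure P] (hU : IsPreBrownian3 U P) (t₀ : ℝ≥0)
    (τ : ℕ → ℝ≥0) :
    IndepFun (U t₀) (fun ω (j : ℕ) => U (t₀ + τ j) ω - U t₀ ω) P := by
  have key := indepFun_pi_of_iIndepFun_prodMk (P := P) (X := fun i ω => U t₀ ω i)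
    (Y := fun i ω (j : ℕ) => U (t₀ + τ j) ω i - U t₀ ω i)
    (fun i => (hU.coord i).aemeasurable t₀)
    (fun i => aemeasurable_pi_lambda _ fun j =>
      ((hU.coord i).aemeasurable _).sub ((hU.coord i).aemeasurable t₀))
    (hU.indep.comp (fun _ w => (w t₀, fun j : ℕ => w (t₀ + τ j) - w t₀))
      (fun _ => (measurable_pi_apply _).prodMk (measurable_pi_lambda _ fun j =>
        (measurable_pi_apply (t₀ + τ j)).sub (measurable_pi_apply t₀))))
    (fun i => by
      have h1 : Measurable fun w : Set.Iic t₀ → ℝ => w ⟨t₀, le_refl t₀⟩ := measurable_pi_apply _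
      have h2 : Measurable fun (w : ℝ≥0 → ℝ) (j : ℕ) => w (τ j) :=
        measurable_pi_lambda _ fun j => measurable_pi_apply (τ j)
      exact ((hU.coord i).indepFun_shift t₀).symm.comp h1 h2)
  exact key.comp (φ := id) (ψ := fun f j i => f i j) measurable_id (by fun_prop)

end IsPreBrownian3

/-! ### Ball probabilities and the Green function. -/

/-- A centred Gaussian variable charges an interval by at most its length times the density at
`0`. -/
lemma gaussianReal_Ioo_le {v : ℝ≥0} (hv : v ≠ 0) (a b : ℝ) :
    gaussianReal 0 v (Set.Ioo a b) ≤ ENNReal.ofReal ((b - a) / √(2 * Real.pi * v)) := by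
  rw [gaussianReal_apply _ hv]
  calc ∫⁻ x in Set.Ioo a b, gaussianPDF 0 v x
      ≤ ∫⁻ _ in Set.Ioo a b, ENNReal.ofReal (√(2 * Real.pi * v))⁻¹ := by
        refine lintegral_mono fun x => ?_
        rw [gaussianPDF_def]
        refine ENNReal.ofReal_le_ofReal ?_
        rw [gaussianPDFReal]
        refine mul_le_of_le_one_right (by positivity) (Real.exp_le_one_iff.2 ?_)
        rw [neg_div]
        exact neg_nonpos.2 (by positivity)
    _ = ENNReal.ofReal ((b - a) / √(2 * Real.pi * v)) := by
        rw [lintegral_const, Measure.restrict_apply_univ, Real.volume_Ioo,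
          ← ENNReal.ofReal_mul (by positivity)]
        congr 1
        ring

namespace IsPreBrownian3

variable {Ω : Type*} [MeasurableSpace Ω] {P : Measure Ω} {U : ℝ≥0 → Ω → Fin 3 → ℝ}

/-- Balls of `Fin 3 → ℝ` are cubes (sup norm), so the probability factors over the coordinates. -/
lemma measure_mem_ball_le (hU : IsPreBrownian3 U P) {s : ℝ≥0} (hs : s ≠ 0)
    (x : Fin 3 → ℝ) {ρ : ℝ} (hρ : 0 < ρ) :
    P {ω | x + U s ω ∈ Metric.ball 0 ρ} ≤
      ENNReal.ofReal ((2 * ρ / √(2 * Real.pi * s)) ^ 3) := by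
  have h1 : {ω | x + U s ω ∈ Metric.ball 0 ρ} =
      ⋂ i ∈ (Finset.univ : Finset (Fin 3)),
        (fun ω (t : ℝ≥0) => U t ω i) ⁻¹' ((fun w => w s) ⁻¹' Set.Ioo (-ρ - x i) (ρ - x i)) := by
    ext ω
    simp only [Set.mem_ofPred_eq, mem_ball_zero_iff, pi_norm_lt_iff hρ, Real.norm_eq_abs, abs_lt,
      Set.mem_iInter, Set.mem_preimage, Set.mem_Ioo, Pi.add_apply, Finset.mem_univ, true_imp_iff]
    refine forall_congr' fun i => and_congr ?_ ?_ <;> constructor <;> intro h <;> linarith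
  rw [h1, hU.indep.measure_inter_preimage_eq_mul Finset.univ
    (fun i _ => measurable_pi_apply s measurableSet_Ioo), ENNReal.ofReal_pow (by positivity)]
  calc ∏ i, P ((fun ω (t : ℝ≥0) => U t ω i) ⁻¹' ((fun w => w s) ⁻¹' Set.Ioo (-ρ - x i) (ρ - x i)))
      ≤ ∏ _i : Fin 3, ENNReal.ofReal (2 * ρ / √(2 * Real.pi * s)) := by
        refine Finset.prod_le_prod' fun i _ => ?_
        have h2 := (hU.coord i).hasLaw_eval s
        have h3 : P ((fun ω (t : ℝ≥0) => U t ω i) ⁻¹'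
            ((fun w => w s) ⁻¹' Set.Ioo (-ρ - x i) (ρ - x i))) =
            gaussianReal 0 s (Set.Ioo (-ρ - x i) (ρ - x i)) := by
          rw [← h2.map_eq, Measure.map_apply_of_aemeasurable h2.aemeasurable measurableSet_Ioo]
          rfl
        rw [h3]
        refine (gaussianReal_Ioo_le hs _ _).trans_eq ?_
        congr 2
        ring
    _ = _ := by simp

/-- Merges the Gaussian bound, used for `ρ ^ 2 ≤ s`, with the trivial bound `1`; the form in `s + ρ
^ 2` is the one that telescopes in `sum_green_le`. -/
lemma measure_mem_ball_le_min [IsProbabilityMeasure P] (hU : IsPreBrownian3 U P) {s : ℝ≥0}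
    (hs : s ≠ 0) (x : Fin 3 → ℝ) {ρ : ℝ} (hρ : 0 < ρ) :
    P {ω | x + U s ω ∈ Metric.ball 0 ρ} ≤ ENNReal.ofReal ((√2 * ρ / √(s + ρ ^ 2)) ^ 3) := by
  have hs' : (0 : ℝ) < s := by positivity
  have h0 : √2 * ρ = √(2 * ρ ^ 2) := by
    rw [Real.sqrt_mul (by norm_num), Real.sqrt_sq hρ.le]
  rcases le_total (s : ℝ) (ρ ^ 2) with h | h
  · refine prob_le_one.trans ?_
    rw [← ENNReal.ofReal_one]
    refine ENNReal.ofReal_le_ofReal (one_le_pow₀ ?_)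
    rw [one_le_div (by positivity), h0]
    exact Real.sqrt_le_sqrt (by linarith)
  · refine (hU.measure_mem_ball_le hs x hρ).trans (ENNReal.ofReal_le_ofReal ?_)
    refine pow_le_pow_left₀ (by positivity) ?_ 3
    rw [div_le_div_iff₀ (by positivity) (by positivity)]
    have h1 : √(s + ρ ^ 2) ≤ √2 * √s := by
      rw [← Real.sqrt_mul (by norm_num)]
      exact Real.sqrt_le_sqrt (by linarith)
    have h2 : 2 * √s ≤ √(2 * Real.pi * s) := by
      refine Real.le_sqrt_of_sq_le ?_
      rw [mul_pow, Real.sq_sqrt hs'.le]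
      nlinarith [Real.pi_gt_three]
    calc 2 * ρ * √(s + ρ ^ 2) ≤ 2 * ρ * (√2 * √s) := by gcongr
      _ = √2 * ρ * (2 * √s) := by ring
      _ ≤ _ := by gcongr

end IsPreBrownian3

/-- The Green function of the walk with time step `h`, over times `h, 2h, …, kh`, is at most of order
`ρ ^ 2 / h`. -/
lemma sum_green_le {h ρ : ℝ} (hh : 0 < h) (hρ : 0 < ρ) (k : ℕ) :
    ∑ j ∈ Finset.range k, (√2 * ρ / √((j + 1) * h + ρ ^ 2)) ^ 3 ≤ 6 * ρ ^ 2 / h := by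
  have h2 : √2 ≤ 3 / 2 := Real.sqrt_le_iff.2 (by norm_num)
  have h2s : √2 ^ 2 = 2 := Real.sq_sqrt (by norm_num)
  set F : ℕ → ℝ := fun j => (√(j * h + ρ ^ 2))⁻¹ with hF
  -- Discrete form of `s ^ (-3/2) = -2 * (s ^ (-1/2))'`; the constant is `2 * √2 * 2` with `√2 ≤ 3 /
  -- 2`.
  have step : ∀ j : ℕ, (√2 * ρ / √((j + 1) * h + ρ ^ 2)) ^ 3 ≤
      6 * ρ ^ 3 / h * (F j - F (j + 1)) := by
    intro j
    have hA : 0 < (j : ℝ) * h + ρ ^ 2 := by positivity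
    have hD : 0 < ((j : ℝ) + 1) * h + ρ ^ 2 := by positivity
    simp only [hF, Nat.cast_add, Nat.cast_one]
    set A := √((j : ℝ) * h + ρ ^ 2) with hAdef
    set D := √(((j : ℝ) + 1) * h + ρ ^ 2) with hDdef
    have hA' : 0 < A := Real.sqrt_pos.2 hA
    have hD' : 0 < D := Real.sqrt_pos.2 hD
    have hAD : A ≤ D := Real.sqrt_le_sqrt (by linarith)
    have hsq : D ^ 2 - A ^ 2 = h := by
      rw [Real.sq_sqrt hD.le, Real.sq_sqrt hA.le]; ring
    have e1 : h / D ^ 3 ≤ 2 * (A⁻¹ - D⁻¹) := by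
      have : 2 * (A⁻¹ - D⁻¹) = 2 * h / (A * D * (A + D)) := by
        rw [← hsq]; field_simp; ring
      rw [this, div_le_div_iff₀ (by positivity) (by positivity)]
      have : A * D * (A + D) ≤ D * D * (D + D) := by gcongr
      nlinarith
    have e2 : (√2 * ρ / D) ^ 3 = 2 * √2 * ρ ^ 3 / h * (h / D ^ 3) := by
      rw [div_pow, mul_pow, pow_succ √2, h2s]; field_simp
    rw [e2]
    calc 2 * √2 * ρ ^ 3 / h * (h / D ^ 3) ≤ 2 * (3 / 2) * ρ ^ 3 / h * (2 * (A⁻¹ - D⁻¹)) := by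
          gcongr
      _ = _ := by ring
  calc _ ≤ ∑ j ∈ Finset.range k, 6 * ρ ^ 3 / h * (F j - F (j + 1)) :=
        Finset.sum_le_sum fun j _ => step j
    _ = 6 * ρ ^ 3 / h * (F 0 - F k) := by rw [← Finset.mul_sum, Finset.sum_range_sub']
    _ ≤ 6 * ρ ^ 3 / h * F 0 := by
        have : 0 ≤ F k := by positivity
        gcongr; linarith
    _ = 6 * ρ ^ 2 / h := by
        simp only [hF, Nat.cast_zero, zero_mul, zero_add, Real.sqrt_sq hρ.le]
        field_simp

/-! ### Khasminskii's lemma for the sampled walk. -/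

/-- Expand the product and group the terms by the smallest index `i` at which `a i` is chosen. -/
lemma prod_one_add_eq_one_add_sum {R : Type*} [CommSemiring R] (k : ℕ) (a : ℕ → R) :
    ∏ j ∈ Finset.range k, (1 + a j) =
      1 + ∑ i ∈ Finset.range k, a i * ∏ j ∈ Finset.range (k - 1 - i), (1 + a (i + 1 + j)) := by
  induction k generalizing a with
  | zero => simp
  | succ k ih =>
    rw [Finset.prod_range_succ', Finset.sum_range_succ', mul_add, mul_one]
    nth_rewrite 1 [ih fun j => a (j + 1)]
    rw [add_assoc]
    congr 2
    · refine Finset.sum_congr rfl fun i hi => ?_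
      rw [show k + 1 - 1 - (i + 1) = k - 1 - i by omega]
      congr 1
      refine Finset.prod_congr rfl fun j _ => ?_
      congr 2
      omega
    · rw [mul_comm]
      congr 1
      simp only [Nat.add_sub_cancel, Nat.sub_zero]
      refine Finset.prod_congr rfl fun j _ => ?_
      congr 2
      omega

section Khasminskii

variable {Ω : Type*}

/-- The exponential weight `∏ (1 + β 1_B)` along the walk `x + U h, x + U (2h), …, x + U (kh)`. -/
noncomputable def walkWeight (U : ℝ≥0 → Ω → Fin 3 → ℝ) (h : ℝ≥0) (B : Set (Fin 3 → ℝ)) (β : ℝ≥0∞)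
    (k : ℕ) (x : Fin 3 → ℝ) (ω : Ω) : ℝ≥0∞ :=
  ∏ j ∈ Finset.range k, (1 + B.indicator (fun _ => β) (x + U (((j + 1 : ℕ) : ℝ≥0) * h) ω))

variable [MeasurableSpace Ω] {P : Measure Ω} [IsProbabilityMeasure P]

/-- After a visit at step `i + 1`, the remaining factors form the weight of a shorter walk restarted
from the current position, with expectation at most `2` by `hk`. -/
lemma lintegral_walkWeight_le_add {h : ℝ≥0} {B : Set (Fin 3 → ℝ)} (hB : MeasurableSet B)
    {β : ℝ≥0∞} {U : ℝ≥0 → Ω → Fin 3 → ℝ} (hU : IsPreBrownian3 U P) (k : ℕ)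
    (hk : ∀ k' < k, ∀ V : ℝ≥0 → Ω → Fin 3 → ℝ, IsPreBrownian3 V P →
      ∀ x, ∫⁻ ω, walkWeight V h B β k' x ω ∂P ≤ 2) (x : Fin 3 → ℝ) :
    ∫⁻ ω, walkWeight U h B β k x ω ∂P ≤
      1 + 2 * β * ∑ i ∈ Finset.range k, P {ω | x + U (((i + 1 : ℕ) : ℝ≥0) * h) ω ∈ B} := by
  have hβ : Measurable (B.indicator (fun _ : Fin 3 → ℝ => β)) := measurable_const.indicator hB
  have hUm : ∀ j : ℕ, AEMeasurable
      (fun ω => B.indicator (fun _ => β) (x + U (((j + 1 : ℕ) : ℝ≥0) * h) ω)) P := fun j =>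
    hβ.comp_aemeasurable ((hU.aemeasurable _).const_add x)
  simp only [walkWeight]
  rw [lintegral_congr fun ω => prod_one_add_eq_one_add_sum k fun j =>
    B.indicator (fun _ => β) (x + U (((j + 1 : ℕ) : ℝ≥0) * h) ω)]
  rw [lintegral_add_left measurable_const, lintegral_const, measure_univ, mul_one]
  gcongr
  rw [lintegral_finsetSum', Finset.mul_sum]
  swap
  · exact fun i _ => (hUm i).mul (Finset.aemeasurable_fun_prod _ fun j _ => (hUm _).const_add 1)
  refine Finset.sum_le_sum fun i hi => ?_
  set t₀ : ℝ≥0 := ((i + 1 : ℕ) : ℝ≥0) * h with ht₀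
  set Y : Ω → ℕ → Fin 3 → ℝ :=
    fun ω j => U (t₀ + ((j + 1 : ℕ) : ℝ≥0) * h) ω - U t₀ ω with hY
  have hYm : AEMeasurable Y P :=
    aemeasurable_pi_lambda _ fun j => (hU.aemeasurable _).sub (hU.aemeasurable _)
  have hind : IndepFun (U t₀) Y P := hU.indepFun_increments t₀ fun j => ((j + 1 : ℕ) : ℝ≥0) * h
  set Φ : (Fin 3 → ℝ) × (ℕ → Fin 3 → ℝ) → ℝ≥0∞ := fun p =>
    B.indicator (fun _ => β) (x + p.1) *
      ∏ j ∈ Finset.range (k - 1 - i), (1 + B.indicator (fun _ => β) (x + p.1 + p.2 j)) with hΦ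
  have hΦm : Measurable Φ := by
    refine (hβ.comp (by fun_prop)).mul (Finset.measurable_fun_prod _ fun j _ =>
      (hβ.comp (by fun_prop)).const_add 1)
  have e1 : ∀ ω, B.indicator (fun _ => β) (x + U t₀ ω) *
      ∏ j ∈ Finset.range (k - 1 - i),
        (1 + B.indicator (fun _ => β) (x + U (((i + 1 + j + 1 : ℕ) : ℝ≥0) * h) ω)) =
      Φ (U t₀ ω, Y ω) := by
    intro ω
    simp only [hΦ, hY]
    congr 1
    refine Finset.prod_congr rfl fun j _ => ?_
    congr 2
    have : ((i + 1 + j + 1 : ℕ) : ℝ≥0) * h = t₀ + ((j + 1 : ℕ) : ℝ≥0) * h := by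
      rw [ht₀]; push_cast; ring
    rw [this]
    abel
  simp_rw [e1]
  rw [lintegral_indepFun (hU.aemeasurable t₀) hYm hind hΦm]
  have e2 : ∀ ω, ∫⁻ ω', Φ (U t₀ ω, Y ω') ∂P ≤
      {ω | x + U t₀ ω ∈ B}.indicator (fun _ => 2 * β) ω := by
    intro ω
    by_cases hω : x + U t₀ ω ∈ B
    · rw [Set.indicator_of_mem (by exact hω)]
      simp only [hΦ, Set.indicator_of_mem hω]
      have := hk (k - 1 - i) (by have := Finset.mem_range.1 hi; omega) _ (hU.shift t₀)
        (x + U t₀ ω)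
      simp only [walkWeight] at this
      rw [lintegral_const_mul'', mul_comm]
      · gcongr
      · refine Finset.aemeasurable_fun_prod _ fun j _ => AEMeasurable.const_add ?_ 1
        exact hβ.comp_aemeasurable (AEMeasurable.const_add
          ((hU.aemeasurable _).sub (hU.aemeasurable _)) _)
    · simp [hΦ, Set.indicator_of_notMem hω]
  refine (lintegral_mono e2).trans ?_
  rw [lintegral_indicator_const₀]
  exact ((hU.aemeasurable t₀).const_add x).nullMeasurable hB

/-- **Khasminskii's lemma** for the walk obtained by sampling Brownian motion at multiples of `h`. -/
lemma lintegral_walkWeight_le_two {h : ℝ≥0} {B : Set (Fin 3 → ℝ)} (hB : MeasurableSet B)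
    {β : ℝ≥0∞} (hg : ∀ (k : ℕ) (V : ℝ≥0 → Ω → Fin 3 → ℝ), IsPreBrownian3 V P → ∀ x,
      2 * β * ∑ i ∈ Finset.range k, P {ω | x + V (((i + 1 : ℕ) : ℝ≥0) * h) ω ∈ B} ≤ 1)
    (k : ℕ) : ∀ U : ℝ≥0 → Ω → Fin 3 → ℝ, IsPreBrownian3 U P → ∀ x,
      ∫⁻ ω, walkWeight U h B β k x ω ∂P ≤ 2 := by
  induction k using Nat.strong_induction_on with
  | _ k ih =>
    intro U hU x
    -- The bound `2` reproduces itself as `1 + 1`, because `hg` makes the Green term at most `1`.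
    refine (lintegral_walkWeight_le_add hB hU k ih x).trans ?_
    calc _ ≤ (1 : ℝ≥0∞) + 1 := add_le_add_right (hg k U hU x) 1
      _ = 2 := one_add_one_eq_two

/-- The exponential moment bound when `B` is a ball of radius `ρ`. -/
lemma lintegral_walkWeight_ball_le {h : ℝ≥0} (hh : h ≠ 0) {ρ : ℝ} (hρ : 0 < ρ) {β : ℝ}
    (hβ : 12 * β * ρ ^ 2 ≤ h) {U : ℝ≥0 → Ω → Fin 3 → ℝ} (hU : IsPreBrownian3 U P) (k : ℕ)
    (x : Fin 3 → ℝ) :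
    ∫⁻ ω, walkWeight U h (Metric.ball 0 ρ) (ENNReal.ofReal β) k x ω ∂P ≤
      1 + 2 * ENNReal.ofReal β *
        ∑ i ∈ Finset.range k, P {ω | x + U (((i + 1 : ℕ) : ℝ≥0) * h) ω ∈ Metric.ball 0 ρ} := by
  have hh' : (0 : ℝ) < h := by positivity
  -- The bound `2` serves only for the shorter walks; the sum is kept because it is later integrated
  -- over `x`.
  refine lintegral_walkWeight_le_add measurableSet_ball hU k (fun k' _ V hV y =>
    lintegral_walkWeight_le_two measurableSet_ball (fun n V hV y => ?_) k' V hV y) x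
  calc 2 * ENNReal.ofReal β *
        ∑ i ∈ Finset.range n, P {ω | y + V (((i + 1 : ℕ) : ℝ≥0) * h) ω ∈ Metric.ball 0 ρ}
      ≤ 2 * ENNReal.ofReal β * ∑ i ∈ Finset.range n,
          ENNReal.ofReal ((√2 * ρ / √((i + 1) * h + ρ ^ 2)) ^ 3) := by
        gcongr with i
        refine (hV.measure_mem_ball_le_min (by positivity) y hρ).trans_eq ?_
        push_cast
        rfl
    _ ≤ 2 * ENNReal.ofReal β * ENNReal.ofReal (6 * ρ ^ 2 / h) := by
        rw [← ENNReal.ofReal_sum_of_nonneg fun i _ => by positivity]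
        gcongr
        exact sum_green_le hh' hρ n
    _ ≤ 1 := by
        rw [← ENNReal.ofReal_ofNat 2, ← ENNReal.ofReal_mul (by norm_num),
          ← ENNReal.ofReal_mul' (by positivity), ← ENNReal.ofReal_one]
        refine ENNReal.ofReal_le_ofReal ?_
        rw [mul_div_assoc', div_le_one hh']
        linarith

end Khasminskii

/-! ### Time spent in a ball, averaged over starting points. -/

section Visits

variable {Ω : Type*}

/-- The number of visits to `B` by the walk `x + U h, x + U (2h), …, x + U (kh)`. -/
noncomputable def visits (U : ℝ≥0 → Ω → Fin 3 → ℝ) (h : ℝ≥0) (B : Set (Fin 3 → ℝ))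
    (k : ℕ) (x : Fin 3 → ℝ) (ω : Ω) : ℝ≥0∞ :=
  ∑ j ∈ Finset.range k, B.indicator (fun _ => 1) (x + U (((j + 1 : ℕ) : ℝ≥0) * h) ω)

/-- With `β = exp (l * h) - 1`, each factor `1 + β 1_B` equals `exp (l * h * 1_B)`. -/
lemma ofReal_exp_le_walkWeight {U : ℝ≥0 → Ω → Fin 3 → ℝ} {h : ℝ≥0} {B : Set (Fin 3 → ℝ)}
    {k : ℕ} {x : Fin 3 → ℝ} {ω : Ω} {l a : ℝ} (hl : 0 ≤ l)
    (ha : ENNReal.ofReal a ≤ h * visits U h B k x ω) :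
    ENNReal.ofReal (Real.exp (l * a)) ≤
      walkWeight U h B (ENNReal.ofReal (Real.exp (l * h) - 1)) k x ω := by
  have h0 : (0 : ℝ) ≤ l * h := by positivity
  have e1 : walkWeight U h B (ENNReal.ofReal (Real.exp (l * h) - 1)) k x ω =
      ENNReal.ofReal (Real.exp (l * (h * ∑ j ∈ Finset.range k,
        B.indicator (fun _ => (1 : ℝ)) (x + U (((j + 1 : ℕ) : ℝ≥0) * h) ω)))) := by
    rw [Finset.mul_sum, Finset.mul_sum, Real.exp_sum, ENNReal.ofReal_prod_of_nonneg
      fun _ _ => (Real.exp_pos _).le, walkWeight]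
    refine Finset.prod_congr rfl fun j _ => ?_
    by_cases hj : x + U (((j + 1 : ℕ) : ℝ≥0) * h) ω ∈ B
    · rw [Set.indicator_of_mem hj, Set.indicator_of_mem hj, ← ENNReal.ofReal_one,
        ← ENNReal.ofReal_add zero_le_one (sub_nonneg.2 (Real.one_le_exp h0))]
      congr 1
      ring_nf
    · simp only [Set.indicator_of_notMem hj]
      simp
  have e2 : h * visits U h B k x ω = ENNReal.ofReal (h * ∑ j ∈ Finset.range k,
      B.indicator (fun _ => (1 : ℝ)) (x + U (((j + 1 : ℕ) : ℝ≥0) * h) ω)) := by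
    rw [ENNReal.ofReal_mul h.coe_nonneg, ENNReal.ofReal_coe_nnreal, ENNReal.ofReal_sum_of_nonneg
      fun _ _ => Set.indicator_nonneg (fun _ _ => zero_le_one) _, visits]
    congr 1
    refine Finset.sum_congr rfl fun j _ => ?_
    by_cases hj : x + U (((j + 1 : ℕ) : ℝ≥0) * h) ω ∈ B
    · simp only [Set.indicator_of_mem hj, ENNReal.ofReal_one]
    · simp only [Set.indicator_of_notMem hj, ENNReal.ofReal_zero]
  rw [e1]
  rw [e2, ENNReal.ofReal_le_ofReal_iff (mul_nonneg h.coe_nonneg (Finset.sum_nonneg fun _ _ =>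
    Set.indicator_nonneg (fun _ _ => zero_le_one) _))] at ha
  exact ENNReal.ofReal_le_ofReal (Real.exp_le_exp.2 (by gcongr))

lemma one_le_walkWeight (U : ℝ≥0 → Ω → Fin 3 → ℝ) (h : ℝ≥0) (B : Set (Fin 3 → ℝ)) (β : ℝ≥0∞)
    (k : ℕ) (x : Fin 3 → ℝ) (ω : Ω) : 1 ≤ walkWeight U h B β k x ω :=
  Finset.one_le_prod' fun _ _ => le_self_add

variable [MeasurableSpace Ω] {P : Measure Ω}

lemma aemeasurable_visits {U : ℝ≥0 → Ω → Fin 3 → ℝ} (hU : ∀ t, AEMeasurable (U t) P) (h : ℝ≥0)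
    {B : Set (Fin 3 → ℝ)} (hB : MeasurableSet B) (k : ℕ) :
    AEMeasurable (fun p : (Fin 3 → ℝ) × Ω => visits U h B k p.1 p.2)
      ((volume : Measure (Fin 3 → ℝ)).prod P) := by
  refine Finset.aemeasurable_fun_sum _ fun j _ => ?_
  refine (measurable_const.indicator hB).comp_aemeasurable (AEMeasurable.add
    measurable_fst.aemeasurable ?_)
  exact (hU _).comp_quasiMeasurePreserving Measure.quasiMeasurePreserving_snd

lemma measurableSet_add_mem {B : Set (Fin 3 → ℝ)} (hB : MeasurableSet B) :
    MeasurableSet {p : (Fin 3 → ℝ) × (Fin 3 → ℝ) | p.1 + p.2 ∈ B} :=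
  (measurable_fst.add measurable_snd) hB

lemma measure_add_mem_eq {X : Ω → Fin 3 → ℝ} (hX : AEMeasurable X P)
    {B : Set (Fin 3 → ℝ)} (hB : MeasurableSet B) (x : Fin 3 → ℝ) :
    P {ω | x + X ω ∈ B} =
      P.map X (Prod.mk x ⁻¹' {p : (Fin 3 → ℝ) × (Fin 3 → ℝ) | p.1 + p.2 ∈ B}) := by
  rw [Measure.map_apply_of_aemeasurable hX (measurable_prodMk_left (measurableSet_add_mem hB))]
  rfl

variable [IsProbabilityMeasure P]

lemma measurable_measure_add_mem {X : Ω → Fin 3 → ℝ} (hX : AEMeasurable X P)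
    {B : Set (Fin 3 → ℝ)} (hB : MeasurableSet B) : Measurable fun x => P {ω | x + X ω ∈ B} := by
  have : IsProbabilityMeasure (P.map X) := Measure.isProbabilityMeasure_map hX
  simp_rw [measure_add_mem_eq hX hB]
  exact measurable_measure_prodMk_left (measurableSet_add_mem hB)

/-- Tonelli and translation invariance of Lebesgue measure. -/
lemma lintegral_measure_add_mem {X : Ω → Fin 3 → ℝ} (hX : AEMeasurable X P)
    {B : Set (Fin 3 → ℝ)} (hB : MeasurableSet B) :
    ∫⁻ x, P {ω | x + X ω ∈ B} = volume B := by
  have : IsProbabilityMeasure (P.map X) := Measure.isProbabilityMeasure_map hX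
  simp_rw [measure_add_mem_eq hX hB]
  rw [← Measure.prod_apply (measurableSet_add_mem hB), Measure.prod_apply_symm (measurableSet_add_mem hB)]
  have h2 : ∀ y : Fin 3 → ℝ, volume ((fun x => (x, y)) ⁻¹'
      {p : (Fin 3 → ℝ) × (Fin 3 → ℝ) | p.1 + p.2 ∈ B}) = volume B :=
    fun y => measure_preimage_add_right volume y B
  simp_rw [h2]
  simp

/-- The expected volume of the set of starting points from which the walk spends time at least `a`
in the ball of radius `ρ` decays exponentially in `a`. -/
lemma lintegral_measure_visits_le {U : ℝ≥0 → Ω → Fin 3 → ℝ} (hU : IsPreBrownian3 U P) {h : ℝ≥0}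
    (hh : h ≠ 0) {ρ l : ℝ} (hρ : 0 < ρ) (hl : 0 < l) (hlρ : 24 * l * ρ ^ 2 ≤ 1) (hlh : l * h ≤ 1)
    (k : ℕ) (a : ℝ) :
    ENNReal.ofReal (Real.exp (l * a) - 1) *
      ∫⁻ x, P {ω | ENNReal.ofReal a ≤ h * visits U h (Metric.ball 0 ρ) k x ω} ≤
      ENNReal.ofReal (4 * l * (k * h) * (2 * ρ) ^ 3) := by
  have hh' : (0 : ℝ) < h := by positivity
  set β : ℝ := Real.exp (l * h) - 1 with hβdef
  have hβ2 : β ≤ 2 * (l * h) := by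
    have := Real.abs_exp_sub_one_le (x := l * h) (by rwa [abs_of_nonneg (by positivity)])
    rw [abs_of_nonneg (by positivity : 0 ≤ l * (h : ℝ))] at this
    exact (le_abs_self _).trans this
  have hβ0 : 0 ≤ β := sub_nonneg.2 (Real.one_le_exp (by positivity))
  have hβ : 12 * β * ρ ^ 2 ≤ h := by
    calc 12 * β * ρ ^ 2 ≤ 12 * (2 * (l * h)) * ρ ^ 2 := by gcongr
      _ = (24 * l * ρ ^ 2) * h := by ring
      _ ≤ 1 * h := by gcongr
      _ = h := one_mul _
  -- The weight is at least `1` everywhere, so the `1` cancels on both sides of the Chebyshev bound.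
  -- This matters: a constant is not integrable over all `x`.
  have key : ∀ x, ENNReal.ofReal (Real.exp (l * a) - 1) *
      P {ω | ENNReal.ofReal a ≤ h * visits U h (Metric.ball 0 ρ) k x ω} ≤
      2 * ENNReal.ofReal β *
        ∑ i ∈ Finset.range k, P {ω | x + U (((i + 1 : ℕ) : ℝ≥0) * h) ω ∈ Metric.ball 0 ρ} := by
    intro x
    have h1 := lintegral_walkWeight_ball_le hh hρ hβ hU k x
    set E := {ω | ENNReal.ofReal a ≤ h * visits U h (Metric.ball 0 ρ) k x ω} with hE
    have hEm : NullMeasurableSet E P := by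
      have : AEMeasurable (fun ω => visits U h (Metric.ball 0 ρ) k x ω) P :=
        Finset.aemeasurable_fun_sum _ fun j _ =>
          (measurable_const.indicator measurableSet_ball).comp_aemeasurable
            ((hU.aemeasurable _).const_add x)
      exact nullMeasurableSet_le aemeasurable_const (this.const_mul _)
    have h2 : ∀ ω, 1 + E.indicator (fun _ => ENNReal.ofReal (Real.exp (l * a) - 1)) ω ≤
        walkWeight U h (Metric.ball 0 ρ) (ENNReal.ofReal β) k x ω := by
      intro ω
      by_cases hω : ω ∈ E
      · rw [Set.indicator_of_mem hω]
        rcases le_total (l * a) 0 with h0 | h0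
        · rw [ENNReal.ofReal_of_nonpos (sub_nonpos.2 (Real.exp_le_one_iff.2 h0)), add_zero]
          exact one_le_walkWeight _ _ _ _ _ _ _
        · refine le_trans (le_of_eq ?_) (ofReal_exp_le_walkWeight hl.le hω)
          rw [← ENNReal.ofReal_one, ← ENNReal.ofReal_add zero_le_one
            (sub_nonneg.2 (Real.one_le_exp h0))]
          congr 1
          ring
      · rw [Set.indicator_of_notMem hω, add_zero]
        exact one_le_walkWeight _ _ _ _ _ _ _
    have h3 := (lintegral_mono h2).trans h1
    rw [lintegral_add_left measurable_const, lintegral_const, measure_univ, mul_one,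
      lintegral_indicator_const₀ hEm] at h3
    exact (ENNReal.add_le_add_iff_left ENNReal.one_ne_top).1 h3
  refine (lintegral_const_mul_le _ _).trans ((lintegral_mono key).trans ?_)
  rw [lintegral_const_mul _ (Finset.measurable_fun_sum _ fun i _ =>
    measurable_measure_add_mem (hU.aemeasurable _) measurableSet_ball),
    lintegral_finsetSum _ fun i _ =>
      measurable_measure_add_mem (hU.aemeasurable _) measurableSet_ball]
  simp_rw [lintegral_measure_add_mem (hU.aemeasurable _) measurableSet_ball]
  rw [Real.volume_pi_ball _ hρ, Finset.sum_const, Finset.card_range, nsmul_eq_mul, Fintype.card_fin,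
    ← ENNReal.ofReal_ofNat 2, ← ENNReal.ofReal_mul (by norm_num), ← ENNReal.ofReal_natCast,
    ← ENNReal.ofReal_mul (by positivity), ← ENNReal.ofReal_mul (by positivity)]
  refine ENNReal.ofReal_le_ofReal ?_
  calc 2 * β * (k * (2 * ρ) ^ 3) ≤ 2 * (2 * (l * h)) * (k * (2 * ρ) ^ 3) := by gcongr
    _ = _ := by ring

end Visits

/-! ### From the sampled walk to continuous time. -/

section RiemannSum

lemma lintegral_floor_eq_sum {h : ℝ} (hh : 0 < h) (G : ℕ → ℝ≥0∞) (N : ℕ) :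
    ∫⁻ s in Set.Ico 0 (N * h), G ⌊s / h⌋₊ = ENNReal.ofReal h * ∑ j ∈ Finset.range N, G j := by
  induction N with
  | zero => simp
  | succ N ih =>
    have hle : (N : ℝ) * h ≤ ((N + 1 : ℕ) : ℝ) * h := by gcongr; simp
    rw [← Set.Ico_union_Ico_eq_Ico (by positivity : 0 ≤ (N : ℝ) * h) hle,
      lintegral_union measurableSet_Ico (Set.Ico_disjoint_Ico_same), ih, Finset.sum_range_succ,
      mul_add]
    congr 1
    rw [setLIntegral_congr_fun (g := fun _ => G N) measurableSet_Ico, lintegral_const,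
      Measure.restrict_apply_univ, Real.volume_Ico, mul_comm]
    · congr 2
      push_cast
      ring
    · intro s hs
      have : ⌊s / h⌋₊ = N := by
        rw [Nat.floor_eq_iff (div_nonneg (le_trans (by positivity) hs.1) hh.le)]
        refine ⟨(le_div_iff₀ hh).2 hs.1, (div_lt_iff₀ hh).2 ?_⟩
        have := hs.2
        push_cast at this
        exact this
      simp only [this]

/-- For a continuous path, the time spent in an open set is at most the lower limit of its Riemann
sums. -/
lemma lintegral_indicator_le_liminf {E : Type*} [TopologicalSpace E] {u : ℝ≥0 → E}
    (hu : Continuous u) {B : Set E} (hB : IsOpen B) {t : ℝ≥0} (ht : t ≠ 0) :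
    ∫⁻ s in Set.Icc (0 : ℝ) t, B.indicator (fun _ => (1 : ℝ≥0∞)) (u s.toNNReal) ≤
      liminf (fun N : ℕ => ((t / N : ℝ≥0) : ℝ≥0∞) * ∑ j ∈ Finset.range N,
        B.indicator (fun _ => 1) (u (((j + 1 : ℕ) : ℝ≥0) * (t / N)))) atTop := by
  have ht' : (0 : ℝ) < t := by positivity
  -- Sampling at right endpoints matches the walk's times `h, …, N * h`. The interval is half-open
  -- because at `s = t` the floor would be `N`.
  set F : ℕ → ℝ → ℝ≥0∞ := fun N s =>
    B.indicator (fun _ => 1) (u (((⌊s / (t / N : ℝ)⌋₊ + 1 : ℕ) : ℝ≥0) * (t / N))) with hF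
  have hFm : ∀ N, Measurable (F N) := fun N =>
    (measurable_of_countable fun n : ℕ =>
      B.indicator (fun _ => (1 : ℝ≥0∞)) (u (((n + 1 : ℕ) : ℝ≥0) * (t / N)))).comp
      (Nat.measurable_floor.comp (measurable_id.div_const _))
  have hsum : ∀ᶠ N : ℕ in atTop, ∫⁻ s in Set.Ico (0 : ℝ) t, F N s =
      ((t / N : ℝ≥0) : ℝ≥0∞) * ∑ j ∈ Finset.range N,
        B.indicator (fun _ => 1) (u (((j + 1 : ℕ) : ℝ≥0) * (t / N))) := by
    filter_upwards [eventually_gt_atTop 0] with N hN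
    have hN' : (0 : ℝ) < N := by exact_mod_cast hN
    have := lintegral_floor_eq_sum (h := t / N) (by positivity)
      (fun j => B.indicator (fun _ => (1 : ℝ≥0∞)) (u (((j + 1 : ℕ) : ℝ≥0) * (t / N)))) N
    rw [mul_div_cancel₀ _ hN'.ne'] at this
    rw [this]
    congr 1
    rw [← ENNReal.ofReal_coe_nnreal]
    push_cast
    rfl
  rw [← liminf_congr hsum, setLIntegral_congr Ico_ae_eq_Icc.symm]
  -- Fatou's lemma; the indicator of an open set is lower semicontinuous.
  refine le_trans (setLIntegral_mono_ae' measurableSet_Ico (ae_of_all _ fun s hs => ?_))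
    (lintegral_liminf_le hFm)
  by_cases hsB : u s.toNNReal ∈ B
  swap
  · rw [Set.indicator_of_notMem hsB]
    exact bot_le
  rw [Set.indicator_of_mem hsB]
  have hlim : Tendsto (fun N : ℕ => ((⌊s / (t / N : ℝ)⌋₊ + 1 : ℕ) : ℝ≥0) * (t / N)) atTop
      (𝓝 s.toNNReal) := by
    rw [← NNReal.tendsto_coe, Real.coe_toNNReal _ hs.1]
    have h1 : Tendsto (fun N : ℕ => s + (t : ℝ) / N) atTop (𝓝 s) := by
      simpa using (tendsto_const_nhds (x := s)).add (tendsto_const_div_atTop_nhds_zero_nat (t : ℝ))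
    refine tendsto_of_tendsto_of_tendsto_of_le_of_le' tendsto_const_nhds h1 ?_ ?_
    all_goals
      filter_upwards [eventually_gt_atTop 0] with N hN
      have hN' : (0 : ℝ) < N := by exact_mod_cast hN
      have hq : (0 : ℝ) < t / N := by positivity
      push_cast
    · rw [← div_le_iff₀ hq]
      exact (Nat.lt_floor_add_one _).le
    · rw [add_mul, one_mul]
      gcongr
      rw [← le_div_iff₀ hq]
      exact Nat.floor_le (div_nonneg hs.1 hq.le)
  have hev : ∀ᶠ N in atTop, F N s = 1 := by
    filter_upwards [(hu.tendsto _).comp hlim (hB.mem_nhds hsB)] with N hN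
    exact Set.indicator_of_mem (s := B) hN _
  rw [liminf_congr hev, liminf_const]

end RiemannSum

/-! ### Tail of the largest occupation time. -/

/-- The occupation time of `ball c r` up to time `t` by the path `u`. -/
noncomputable def occupation (u : ℝ≥0 → Fin 3 → ℝ) (t : ℝ) (c : Fin 3 → ℝ) (r : ℝ) : ℝ≥0∞ :=
  ∫⁻ s in Set.Icc (0 : ℝ) t, (Metric.ball c r).indicator (fun _ => 1) (u s.toNNReal)

lemma aemeasurable_liminf {Ω : Type*} [MeasurableSpace Ω] {P : Measure Ω} {f : ℕ → Ω → ℝ≥0∞}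
    (hf : ∀ n, AEMeasurable (f n) P) : AEMeasurable (fun ω => liminf (fun n => f n ω) atTop) P := by
  refine ⟨fun ω => liminf (fun n => (hf n).mk _ ω) atTop,
    Measurable.liminf fun n => (hf n).measurable_mk, ?_⟩
  filter_upwards [ae_all_iff.2 fun n => (hf n).ae_eq_mk] with ω hω
  simp_rw [hω]

/-- Exponential tail of the largest occupation time of a ball of radius `r`. -/
lemma measure_exists_occupation_ge_le {Ω : Type*} [MeasurableSpace Ω] {P : Measure Ω}
    [IsProbabilityMeasure P] {U : ℝ≥0 → Ω → Fin 3 → ℝ} (hU : IsPreBrownian3 U P)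
    (hc : ∀ᵐ ω ∂P, Continuous fun t => U t ω) {t r a : ℝ} (ht : 0 < t) (hr : 0 < r) (ha : 0 < a) :
    P {ω | ∃ c, ENNReal.ofReal a ≤ occupation (fun s => U s ω) t c r} ≤
      ENNReal.ofReal (t / (3 * r ^ 2) / (Real.exp (a / (192 * r ^ 2)) - 1)) := by
  lift t to ℝ≥0 using ht.le
  have ht0 : t ≠ 0 := by rintro rfl; simp at ht
  -- Equality in `24 * l * ρ ^ 2 ≤ 1` for `ρ = 2 * r`.
  set l : ℝ := 1 / (96 * r ^ 2) with hl
  have hl0 : 0 < l := by positivity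
  have hla : l * (a / 2) = a / (192 * r ^ 2) := by rw [hl]; field_simp; norm_num
  set M : ℝ := Real.exp (a / (192 * r ^ 2)) - 1 with hM
  have hM0 : 0 < M := sub_pos.2 (Real.one_lt_exp_iff.2 (by positivity))
  set B : Set (Fin 3 → ℝ) := Metric.ball 0 (2 * r) with hB
  -- The threshold is `a / 2` because a lower limit at least `a` only forces the Riemann sums
  -- eventually above values strictly below `a`.
  set E : ℕ → Set ((Fin 3 → ℝ) × Ω) := fun N =>
    {p | ENNReal.ofReal (a / 2) ≤ ((t / N : ℝ≥0) : ℝ≥0∞) * visits U (t / N) B N p.1 p.2} with hE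
  have hEm : ∀ N, NullMeasurableSet (E N) (volume.prod P) := fun N =>
    nullMeasurableSet_le aemeasurable_const
      ((aemeasurable_visits hU.aemeasurable _ measurableSet_ball N).const_mul _)
  set J : ℕ → (Fin 3 → ℝ) → Ω → ℝ≥0∞ := fun N x ω => (E N).indicator (fun _ => 1) (x, ω) with hJ
  have hJm : ∀ N, AEMeasurable (fun p : (Fin 3 → ℝ) × Ω => J N p.1 p.2) (volume.prod P) :=
    fun N => aemeasurable_const.indicator₀ (hEm N)
  have hJx : ∀ N ω, Measurable fun x => J N x ω := by
    intro N ω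
    refine measurable_const.indicator (s := {x | ENNReal.ofReal (a / 2) ≤
      ((t / N : ℝ≥0) : ℝ≥0∞) * visits U (t / N) B N x ω}) (measurableSet_le measurable_const
        (Measurable.const_mul (Finset.measurable_fun_sum _ fun j _ => ?_) _))
    exact (measurable_const.indicator measurableSet_ball).comp (measurable_id.add_const _)
  have hJω : ∀ N x, ∫⁻ ω, J N x ω ∂P =
      P {ω | ENNReal.ofReal (a / 2) ≤ ((t / N : ℝ≥0) : ℝ≥0∞) * visits U (t / N) B N x ω} := by
    intro N x
    refine (lintegral_indicator_const₀ (s := {ω | ENNReal.ofReal (a / 2) ≤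
      ((t / N : ℝ≥0) : ℝ≥0∞) * visits U (t / N) B N x ω}) ?_ 1).trans (one_mul _)
    have : AEMeasurable (fun ω => visits U (t / N) B N x ω) P :=
      Finset.aemeasurable_fun_sum _ fun j _ =>
        (measurable_const.indicator measurableSet_ball).comp_aemeasurable
          ((hU.aemeasurable _).const_add x)
    exact nullMeasurableSet_le aemeasurable_const (this.const_mul _)
  have hbound : ∀ᶠ N : ℕ in atTop,
      ∫⁻ ω, (∫⁻ x, J N x ω) ∂P ≤ ENNReal.ofReal (4 * l * t * (4 * r) ^ 3 / M) := by
    have hlim : Tendsto (fun N : ℕ => l * ((t : ℝ) / N)) atTop (𝓝 0) := by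
      simpa using (tendsto_const_div_atTop_nhds_zero_nat (t : ℝ)).const_mul l
    filter_upwards [eventually_gt_atTop 0, hlim.eventually_le_const zero_lt_one] with N hN hN1
    have hN' : (N : ℝ) ≠ 0 := by positivity
    rw [lintegral_lintegral_swap (hJm N).prod_swap]
    simp_rw [hJω]
    have h1 := lintegral_measure_visits_le hU (h := t / N) (by positivity) (ρ := 2 * r) (l := l)
      (by positivity) hl0 (by rw [hl]; apply le_of_eq; field_simp; norm_num)
      (by push_cast; exact hN1) N (a / 2)
    rw [hla, mul_comm] at h1
    rw [ENNReal.ofReal_div_of_pos hM0, ENNReal.le_div_iff_mul_le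
      (Or.inl (by simpa using hM0)) (Or.inl ENNReal.ofReal_ne_top)]
    refine h1.trans (ENNReal.ofReal_le_ofReal (le_of_eq ?_))
    push_cast
    rw [mul_div_cancel₀ _ hN']
    ring
  -- One heavily occupied ball yields a whole ball `ball (-c) r` of starting points `x` with `J N x
  -- ω = 1` eventually; Fatou in `x` gives the volume.
  have hsub : ∀ᵐ ω ∂P, (∃ c, ENNReal.ofReal a ≤ occupation (fun s => U s ω) t c r) →
      ENNReal.ofReal ((2 * r) ^ 3) ≤ liminf (fun N => ∫⁻ x, J N x ω) atTop := by
    filter_upwards [hc] with ω hω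
    rintro ⟨c, hcω⟩
    refine le_trans ?_ (lintegral_liminf_le fun N => hJx N ω)
    have hv : volume (Metric.ball (-c) r) = ENNReal.ofReal ((2 * r) ^ 3) := by
      rw [Real.volume_pi_ball _ hr, Fintype.card_fin]
    rw [← hv, ← one_mul (volume (Metric.ball (-c) r)),
      ← lintegral_indicator_const measurableSet_ball]
    refine lintegral_mono fun x => ?_
    by_cases hx : x ∈ Metric.ball (-c) r
    swap
    · rw [Set.indicator_of_notMem hx]
      exact zero_le
    rw [Set.indicator_of_mem hx]
    have h1 : ENNReal.ofReal a ≤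
        liminf (fun N : ℕ => ((t / N : ℝ≥0) : ℝ≥0∞) * visits U (t / N) B N x ω) atTop := by
      refine hcω.trans (le_trans (lintegral_mono fun s => ?_) (lintegral_indicator_le_liminf
        (u := fun s => x + U s ω) (hω.const_add x) (Metric.isOpen_ball (x := 0) (ε := 2 * r)) ht0))
      by_cases hs : U s.toNNReal ω ∈ Metric.ball c r
      · have : x + U s.toNNReal ω ∈ Metric.ball 0 (2 * r) := by
          rw [mem_ball_zero_iff]
          rw [Metric.mem_ball, dist_eq_norm] at hs hx
          calc ‖x + U s.toNNReal ω‖ = ‖(x - -c) + (U s.toNNReal ω - c)‖ := by congr 1; abel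
            _ ≤ _ := norm_add_le _ _
            _ < 2 * r := by linarith
        simp only [Set.indicator_of_mem hs, Set.indicator_of_mem this, le_refl]
      · simp only [Set.indicator_of_notMem hs]
        exact zero_le
    have h2 : ENNReal.ofReal (a / 2) < ENNReal.ofReal a :=
      (ENNReal.ofReal_lt_ofReal_iff ha).2 (by linarith)
    have h3 : ∀ᶠ N in atTop, J N x ω = 1 := by
      filter_upwards [eventually_lt_of_lt_liminf (h2.trans_le h1)] with N hN
      exact Set.indicator_of_mem (show (x, ω) ∈ E N from hN.le) _
    rw [liminf_congr h3, liminf_const]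
  have hJωm : ∀ N, AEMeasurable (fun ω => ∫⁻ x, J N x ω) P := fun N =>
    (hJm N).prod_swap.lintegral_prod_right'
  have hv0 : 0 < (2 * r) ^ 3 := by positivity
  calc P {ω | ∃ c, ENNReal.ofReal a ≤ occupation (fun s => U s ω) t c r}
      ≤ P {ω | ENNReal.ofReal ((2 * r) ^ 3) ≤ liminf (fun N => ∫⁻ x, J N x ω) atTop} :=
        measure_mono_ae hsub
    _ ≤ ENNReal.ofReal (4 * l * t * (4 * r) ^ 3 / M) / ENNReal.ofReal ((2 * r) ^ 3) := by
        rw [ENNReal.le_div_iff_mul_le (Or.inl (by simpa using hv0)) (Or.inl ENNReal.ofReal_ne_top),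
          mul_comm]
        -- Markov's inequality, then Fatou in `ω`.
        refine (mul_meas_ge_le_lintegral₀ (aemeasurable_liminf hJωm) _).trans
          ((lintegral_liminf_le' hJωm).trans ?_)
        exact (liminf_le_liminf hbound).trans_eq (liminf_const _)
    _ = _ := by
        rw [← ENNReal.ofReal_div_of_pos hv0, hl]
        congr 1
        field_simp
        norm_num

/-! ### Multi-scale splitting of the Coulomb kernel. -/

/-- The multi-scale majorant of the Coulomb kernel near the origin. -/
noncomputable def nearKernel (ε : ℝ) (y : Fin 3 → ℝ) : ℝ≥0∞ :=
  ∑' k : ℕ, ENNReal.ofReal (4 ^ (k + 1) / ε) *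
    (Metric.ball 0 (ε / 4 ^ k)).indicator (fun _ => 1) y

/-- The single term with `ε / 4 ^ (k + 1) ≤ ‖y‖ < ε / 4 ^ k` suffices, the sup norm being at most
the Euclidean one. At `y = 0` all terms are at least `4 / ε` and the series diverges. -/
lemma inv_enorm_le_nearKernel {ε : ℝ} (hε : 0 < ε) {y : EuclideanSpace ℝ (Fin 3)}
    (hy : ‖y‖ < ε) : ‖y‖ₑ⁻¹ ≤ nearKernel ε (WithLp.ofLp y) := by
  have hsup : ‖WithLp.ofLp y‖ ≤ ‖y‖ :=
    (pi_norm_le_iff_of_nonneg (norm_nonneg y)).2 fun i => PiLp.norm_apply_le y i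
  rcases eq_or_ne y 0 with rfl | hy0
  · have h1 : nearKernel ε (WithLp.ofLp (0 : EuclideanSpace ℝ (Fin 3))) = ⊤ := by
      rw [nearKernel, ← top_le_iff,
        ← ENNReal.tsum_const_eq_top_of_ne_zero (α := ℕ) (c := ENNReal.ofReal (4 / ε))
          (by simpa using (by positivity : 0 < 4 / ε))]
      refine ENNReal.tsum_le_tsum fun k => ?_
      rw [Set.indicator_of_mem, mul_one]
      · refine ENNReal.ofReal_le_ofReal ?_
        have : (1 : ℝ) ≤ 4 ^ k := one_le_pow₀ (by norm_num)
        gcongr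
        rw [pow_succ]
        linarith
      · simpa using (by positivity : 0 < ε / 4 ^ k)
    rw [h1]
    exact le_top
  have hpos : 0 < ‖y‖ := norm_pos_iff.2 hy0
  have hex : ∃ k : ℕ, ε / 4 ^ (k + 1) ≤ ‖y‖ := by
    obtain ⟨n, hn⟩ := pow_unbounded_of_one_lt (ε / ‖y‖) (by norm_num : (1 : ℝ) < 4)
    refine ⟨n, ?_⟩
    rw [div_lt_iff₀ hpos] at hn
    rw [div_le_iff₀ (by positivity), pow_succ]
    nlinarith [pow_pos (by norm_num : (0 : ℝ) < 4) n]
  set k := Nat.find hex with hk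
  have h1 : ε / 4 ^ (k + 1) ≤ ‖y‖ := Nat.find_spec hex
  have h2 : ‖y‖ < ε / 4 ^ k := by
    rcases Nat.eq_zero_or_pos k with h0 | h0
    · rw [h0]; simpa using hy
    · have := Nat.find_min hex (m := k - 1) (by omega)
      rw [Nat.sub_add_cancel h0] at this
      exact not_le.1 this
  refine le_trans ?_ (ENNReal.le_tsum k)
  rw [Set.indicator_of_mem (by rw [mem_ball_zero_iff]; exact hsup.trans_lt h2), mul_one,
    ← ofReal_norm, ← ENNReal.ofReal_inv_of_pos hpos]
  refine ENNReal.ofReal_le_ofReal ?_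
  rw [← inv_div]
  exact inv_anti₀ (by positivity) h1

lemma inv_enorm_le_add {ε : ℝ} (hε : 0 < ε) (y : EuclideanSpace ℝ (Fin 3)) :
    ‖y‖ₑ⁻¹ ≤ ENNReal.ofReal (1 / ε) + nearKernel ε (WithLp.ofLp y) := by
  rcases lt_or_ge ‖y‖ ε with h | h
  · exact (inv_enorm_le_nearKernel hε h).trans le_add_self
  · refine le_trans ?_ le_self_add
    rw [← ofReal_norm, ← ENNReal.ofReal_inv_of_pos (hε.trans_le h), one_div]
    exact ENNReal.ofReal_le_ofReal (inv_anti₀ hε h)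

/-- Only `y₁` needs the near kernel: if `‖y₁‖ ≥ ε`, either `y₂` is closer to the origin and the
bound is trivial, or both points lie where the kernel is Lipschitz. -/
lemma inv_enorm_le_inv_enorm_add {ε δ : ℝ} (hε : 0 < ε) {y₁ y₂ : EuclideanSpace ℝ (Fin 3)}
    (h12 : dist y₁ y₂ ≤ δ) :
    ‖y₁‖ₑ⁻¹ ≤ ‖y₂‖ₑ⁻¹ + ENNReal.ofReal (δ / ε ^ 2) + nearKernel ε (WithLp.ofLp y₁) := by
  rcases lt_or_ge ‖y₁‖ ε with h | h
  · exact (inv_enorm_le_nearKernel hε h).trans le_add_self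
  refine le_trans ?_ le_self_add
  rcases le_total ‖y₂‖ ‖y₁‖ with h21 | h21
  · refine le_trans (ENNReal.inv_le_inv.2 ?_) le_self_add
    rw [← ofReal_norm, ← ofReal_norm]
    exact ENNReal.ofReal_le_ofReal h21
  have h1 : 0 < ‖y₁‖ := hε.trans_le h
  have h2 : 0 < ‖y₂‖ := h1.trans_le h21
  have hδ : 0 ≤ δ := dist_nonneg.trans h12
  rw [← ofReal_norm, ← ofReal_norm, ← ENNReal.ofReal_inv_of_pos h1,
    ← ENNReal.ofReal_inv_of_pos h2, ← ENNReal.ofReal_add (by positivity) (by positivity)]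
  refine ENNReal.ofReal_le_ofReal ?_
  have h3 : ‖y₂‖ - ‖y₁‖ ≤ δ := by
    rw [dist_comm, dist_eq_norm] at h12
    exact (norm_sub_norm_le _ _).trans h12
  have h4 : ‖y₁‖⁻¹ - ‖y₂‖⁻¹ = (‖y₂‖ - ‖y₁‖) / (‖y₁‖ * ‖y₂‖) := by field_simp
  have h5 : (‖y₂‖ - ‖y₁‖) / (‖y₁‖ * ‖y₂‖) ≤ δ / ε ^ 2 := by
    rw [pow_two]
    gcongr
    exact h.trans h21
  linarith

lemma measurable_nearKernel (ε : ℝ) : Measurable (nearKernel ε) :=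
  Measurable.tsum fun _ =>
    (measurable_const.indicator measurableSet_ball).const_mul _

section Path

variable {w : ℝ≥0 → EuclideanSpace ℝ (Fin 3)} {t ε η : ℝ}

/-- If all occupation times of balls are small at every scale, then so is the contribution of the
singular part of the kernel. -/
lemma lintegral_nearKernel_le (hw : Continuous w) (ht : 0 < t) (hε : 0 < ε) (hη : 0 < η)
    (hocc : ∀ (k : ℕ) c, occupation (fun s => WithLp.ofLp (w s)) t c (ε / 4 ^ k) ≤
      ENNReal.ofReal (η * ε * t / 8 ^ k)) (x : EuclideanSpace ℝ (Fin 3)) :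
    (ENNReal.ofReal t)⁻¹ *
      ∫⁻ s in Set.Icc (0 : ℝ) t, nearKernel ε (WithLp.ofLp (w s.toNNReal - x)) ≤
      ENNReal.ofReal (8 * η) := by
  have hm : Measurable fun s : ℝ => WithLp.ofLp (w s.toNNReal - x) := by
    have : Continuous fun s : ℝ => WithLp.ofLp (w s.toNNReal - x) := by fun_prop
    exact this.measurable
  simp only [nearKernel]
  rw [lintegral_tsum]
  swap
  · exact fun k => (((measurable_const.indicator measurableSet_ball).const_mul _).comp
      hm).aemeasurable
  -- Weight times occupation is `4 * η * t / 2 ^ k`, which sums to `8 * η * t`.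
  have h1 : ∀ k : ℕ, ∫⁻ s in Set.Icc (0 : ℝ) t, ENNReal.ofReal (4 ^ (k + 1) / ε) *
      (Metric.ball 0 (ε / 4 ^ k)).indicator (fun _ => 1) (WithLp.ofLp (w s.toNNReal - x)) ≤
      ENNReal.ofReal (4 * η * t * (1 / 2) ^ k) := by
    intro k
    rw [lintegral_const_mul]
    swap
    · exact (measurable_const.indicator measurableSet_ball).comp hm
    have h2 : ∫⁻ s in Set.Icc (0 : ℝ) t, (Metric.ball 0 (ε / 4 ^ k)).indicator
        (fun _ => (1 : ℝ≥0∞)) (WithLp.ofLp (w s.toNNReal - x)) =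
        occupation (fun s => WithLp.ofLp (w s)) t (WithLp.ofLp x) (ε / 4 ^ k) := by
      refine lintegral_congr fun s => ?_
      have h3 : WithLp.ofLp (w s.toNNReal - x) ∈ Metric.ball 0 (ε / 4 ^ k) ↔
          WithLp.ofLp (w s.toNNReal) ∈ Metric.ball (WithLp.ofLp x) (ε / 4 ^ k) := by
        rw [mem_ball_zero_iff, WithLp.ofLp_sub, Metric.mem_ball, dist_eq_norm]
      by_cases h4 : WithLp.ofLp (w s.toNNReal) ∈ Metric.ball (WithLp.ofLp x) (ε / 4 ^ k)
      · rw [Set.indicator_of_mem (h3.2 h4), Set.indicator_of_mem h4]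
      · rw [Set.indicator_of_notMem (mt h3.1 h4), Set.indicator_of_notMem h4]
    rw [h2]
    refine (mul_le_mul_right (hocc k _) _).trans_eq ?_
    rw [← ENNReal.ofReal_mul (by positivity)]
    congr 1
    rw [show (8 : ℝ) ^ k = 4 ^ k * 2 ^ k by rw [← mul_pow]; norm_num, one_div, inv_pow, pow_succ]
    field_simp
  calc _ ≤ (ENNReal.ofReal t)⁻¹ * ∑' k : ℕ, ENNReal.ofReal (4 * η * t * (1 / 2) ^ k) := by
        gcongr with k
        exact h1 k
    _ = ENNReal.ofReal (8 * η) := by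
        rw [← ENNReal.ofReal_tsum_of_nonneg (fun k => by positivity)
          (summable_geometric_two.mul_left _), tsum_mul_left, tsum_geometric_two,
          ← ENNReal.ofReal_inv_of_pos ht, ← ENNReal.ofReal_mul (by positivity)]
        congr 1
        field_simp
        norm_num

lemma abs_coe_sub_coe_le {p q : ℝ≥0∞} (hp : p ≠ ⊤) (hq : q ≠ ⊤) {c : ℝ} (hc : 0 ≤ c)
    (hpq : p ≤ q + ENNReal.ofReal c) (hqp : q ≤ p + ENNReal.ofReal c) :
    ((p : EReal) - (q : EReal)).abs ≤ ENNReal.ofReal c := by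
  lift p to ℝ≥0 using hp
  lift q to ℝ≥0 using hq
  lift c to ℝ≥0 using hc
  rw [ENNReal.ofReal_coe_nnreal] at hpq hqp
  have h1 : (p : ℝ) ≤ q + c := by exact_mod_cast hpq
  have h2 : (q : ℝ) ≤ p + c := by exact_mod_cast hqp
  have h3 : (((p : ℝ≥0∞) : EReal) - ((q : ℝ≥0∞) : EReal)) = (((p : ℝ) - (q : ℝ) : ℝ) : EReal) := rfl
  rw [h3, EReal.abs_def]
  exact ENNReal.ofReal_le_ofReal (abs_le.2 ⟨by linarith, by linarith⟩)

lemma coulombOscillation_le (hw : Continuous w) (ht : 0 < t) (hε : 0 < ε) (hη : 0 < η) {δ : ℝ}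
    (hδ : 0 ≤ δ) (hocc : ∀ (k : ℕ) c, occupation (fun s => WithLp.ofLp (w s)) t c (ε / 4 ^ k) ≤
      ENNReal.ofReal (η * ε * t / 8 ^ k)) :
    coulombOscillation w t δ ≤ ENNReal.ofReal (δ / ε ^ 2 + 8 * η) := by
  have hm : ∀ x, Measurable fun s : ℝ => nearKernel ε (WithLp.ofLp (w s.toNNReal - x)) := by
    intro x
    have : Continuous fun s : ℝ => WithLp.ofLp (w s.toNNReal - x) := by fun_prop
    exact (measurable_nearKernel ε).comp this.measurable
  have ht0 : ENNReal.ofReal t ≠ 0 := by simpa using ht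
  have hconst : ∀ c : ℝ≥0∞, (ENNReal.ofReal t)⁻¹ * ∫⁻ _ in Set.Icc (0 : ℝ) t, c = c := by
    intro c
    rw [lintegral_const, Measure.restrict_apply_univ, Real.volume_Icc, sub_zero, mul_comm c,
      ← mul_assoc, ENNReal.inv_mul_cancel ht0 ENNReal.ofReal_ne_top, one_mul]
  -- Finiteness is needed because `∞ - ∞` counts as infinite oscillation.
  have hfin : ∀ x, coulombFunctional w t x ≠ ⊤ := by
    intro x
    refine ne_top_of_le_ne_top (b := ENNReal.ofReal (1 / ε) + ENNReal.ofReal (8 * η))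
      (ENNReal.add_ne_top.2 ⟨ENNReal.ofReal_ne_top, ENNReal.ofReal_ne_top⟩) ?_
    calc coulombFunctional w t x ≤ (ENNReal.ofReal t)⁻¹ * ∫⁻ s in Set.Icc (0 : ℝ) t,
          (ENNReal.ofReal (1 / ε) + nearKernel ε (WithLp.ofLp (w s.toNNReal - x))) := by
          rw [coulombFunctional]
          gcongr
          exact inv_enorm_le_add hε _
      _ ≤ _ := by
          rw [lintegral_add_left measurable_const, mul_add, hconst]
          gcongr
          exact lintegral_nearKernel_le hw ht hε hη hocc x
  have hle : ∀ x₁ x₂, dist x₁ x₂ ≤ δ → coulombFunctional w t x₁ ≤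
      coulombFunctional w t x₂ + ENNReal.ofReal (δ / ε ^ 2 + 8 * η) := by
    intro x₁ x₂ h12
    calc coulombFunctional w t x₁ ≤ (ENNReal.ofReal t)⁻¹ * ∫⁻ s in Set.Icc (0 : ℝ) t,
          (‖w s.toNNReal - x₂‖ₑ⁻¹ + ENNReal.ofReal (δ / ε ^ 2) +
            nearKernel ε (WithLp.ofLp (w s.toNNReal - x₁))) := by
          rw [coulombFunctional]
          gcongr with s
          exact inv_enorm_le_inv_enorm_add hε (by rwa [dist_sub_left])
      _ ≤ _ := by
          rw [lintegral_add_right _ (hm x₁), lintegral_add_right _ measurable_const, mul_add,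
            mul_add, hconst, ENNReal.ofReal_add (by positivity) (by positivity), ← add_assoc]
          rw [coulombFunctional]
          gcongr
          exact lintegral_nearKernel_le hw ht hε hη hocc x₁
  refine iSup_le fun x₁ => iSup_le fun x₂ => iSup_le fun h12 => ?_
  exact abs_coe_sub_coe_le (hfin _) (hfin _) (by positivity) (hle _ _ h12)
    (hle _ _ (by rwa [dist_comm]))

end Path

/-! ### Summation over scales and the exponential rate. -/

/-- Since `2 ^ k ≥ k + 1` and `exp u ≥ 32`, the exponential is at least `exp u * 32 ^ k`, which
beats `16 ^ k` with ratio `1 / 2`; dropping the `-1` costs a factor `2`. -/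
lemma tsum_tail_le {u C : ℝ} (hu : 4 ≤ u) (hC : 0 ≤ C) :
    ∑' k : ℕ, ENNReal.ofReal (C * 16 ^ k / (Real.exp (u * 2 ^ k) - 1)) ≤
      ENNReal.ofReal (4 * C * Real.exp (-u)) := by
  have hexp : 32 ≤ Real.exp u := by
    refine le_trans ?_ (Real.exp_le_exp.2 hu)
    have h1 : Real.exp 4 = Real.exp 1 ^ 4 := by rw [← Real.exp_nat_mul]; norm_num
    rw [h1]
    calc (32 : ℝ) ≤ 2.7 ^ 4 := by norm_num
      _ ≤ _ := by gcongr; linarith [Real.exp_one_gt_d9]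
  have hterm : ∀ k : ℕ, C * 16 ^ k / (Real.exp (u * 2 ^ k) - 1) ≤
      2 * C * Real.exp (-u) * (1 / 2) ^ k := by
    intro k
    have hk : (k : ℝ) + 1 ≤ 2 ^ k := by exact_mod_cast Nat.lt_two_pow_self
    have h1 : Real.exp u * 32 ^ k ≤ Real.exp (u * 2 ^ k) := by
      calc Real.exp u * 32 ^ k ≤ Real.exp u * Real.exp u ^ k := by gcongr
        _ = Real.exp (u * (k + 1)) := by
          rw [← Real.exp_nat_mul, ← Real.exp_add]
          congr 1
          ring
        _ ≤ _ := Real.exp_le_exp.2 (by gcongr)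
    have h32 : (1 : ℝ) ≤ 32 ^ k := one_le_pow₀ (by norm_num)
    have h2 : Real.exp u * 32 ^ k / 2 ≤ Real.exp (u * 2 ^ k) - 1 := by nlinarith
    calc C * 16 ^ k / (Real.exp (u * 2 ^ k) - 1) ≤ C * 16 ^ k / (Real.exp u * 32 ^ k / 2) := by
          gcongr
      _ = _ := by
          rw [Real.exp_neg, show (32 : ℝ) ^ k = 16 ^ k * 2 ^ k by rw [← mul_pow]; norm_num,
            one_div, inv_pow]
          field_simp
  calc _ ≤ ∑' k : ℕ, ENNReal.ofReal (2 * C * Real.exp (-u) * (1 / 2) ^ k) :=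
        ENNReal.tsum_le_tsum fun k => ENNReal.ofReal_le_ofReal (hterm k)
    _ = _ := by
        rw [← ENNReal.ofReal_tsum_of_nonneg (fun k => by positivity)
          (summable_geometric_two.mul_left _), tsum_mul_left, tsum_geometric_two]
        congr 1
        ring

section Main

variable {Ω : Type*} [MeasurableSpace Ω] {P : Measure Ω} {W : ℝ≥0 → Ω → EuclideanSpace ℝ (Fin 3)}

namespace IsBrownianMotion3

lemma isPreBrownian3 (hW : IsBrownianMotion3 W P) :
    IsPreBrownian3 (fun t ω => WithLp.ofLp (W t ω)) P where
  coord i := (hW.isBrownianReal i).toIsPreBrownianReal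
  indep := hW.iIndepFun

lemma ae_continuous (hW : IsBrownianMotion3 W P) : ∀ᵐ ω ∂P, Continuous fun t => W t ω := by
  filter_upwards [ae_all_iff.2 fun i => (hW.isBrownianReal i).cont] with ω hω
  exact (PiLp.continuous_toLp 2 _).comp (continuous_pi hω)

end IsBrownianMotion3

/-- Exponential bound for the oscillation, with a rate that is of order `1 / ε`. -/
lemma measure_coulombOscillation_ge_le [IsProbabilityMeasure P] (hW : IsBrownianMotion3 W P)
    {b ε δ t : ℝ} (hb : 0 < b) (hε : 0 < ε) (hδ : 0 ≤ δ) (hδε : δ / ε ^ 2 < b / 2)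
    (ht : 12288 * ε / b ≤ t) :
    P {ω | ENNReal.ofReal b ≤ coulombOscillation (fun s => W s ω) t δ} ≤
      ENNReal.ofReal (2 / ε ^ 2 * t * Real.exp (-(b / (3072 * ε) * t))) := by
  have ht0 : 0 < t := lt_of_lt_of_le (by positivity) ht
  set U : ℝ≥0 → Ω → Fin 3 → ℝ := fun t ω => WithLp.ofLp (W t ω) with hU
  -- With `η = b / 16` the singular part contributes at most `8 * η = b / 2`. The base `8` lies
  -- between `4`, needed to sum the kernel weights, and `16`, needed for the exponent `a k / r ^ 2`
  -- to grow with `k`.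
  set a : ℕ → ℝ := fun k => b / 16 * ε * t / 8 ^ k with ha
  have hsub : ∀ᵐ ω ∂P, ENNReal.ofReal b ≤ coulombOscillation (fun s => W s ω) t δ →
      ω ∈ ⋃ k, {ω | ∃ c, ENNReal.ofReal (a k) ≤ occupation (fun s => U s ω) t c (ε / 4 ^ k)} := by
    filter_upwards [hW.ae_continuous] with ω hω hbω
    by_contra hcon
    simp only [Set.mem_iUnion, Set.mem_ofPred_eq, not_exists, not_le] at hcon
    have := hbω.trans (coulombOscillation_le hω ht0 hε (by positivity : 0 < b / 16) hδ
      fun k c => (hcon k c).le)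
    rw [ENNReal.ofReal_le_ofReal_iff (by positivity)] at this
    linarith
  have hcont : ∀ᵐ ω ∂P, Continuous fun t => U t ω := by
    filter_upwards [hW.ae_continuous] with ω hω
    exact (PiLp.continuous_ofLp 2 _).comp hω
  have hu : 4 ≤ b / (3072 * ε) * t := by
    rw [div_le_iff₀ hb] at ht
    rw [div_mul_eq_mul_div, le_div_iff₀ (by positivity)]
    linarith
  calc _ ≤ P (⋃ k, {ω | ∃ c, ENNReal.ofReal (a k) ≤
          occupation (fun s => U s ω) t c (ε / 4 ^ k)}) := measure_mono_ae hsub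
    _ ≤ ∑' k, P {ω | ∃ c, ENNReal.ofReal (a k) ≤
          occupation (fun s => U s ω) t c (ε / 4 ^ k)} := measure_iUnion_le _
    _ ≤ ∑' k : ℕ, ENNReal.ofReal (t / (3 * ε ^ 2) * 16 ^ k /
          (Real.exp (b / (3072 * ε) * t * 2 ^ k) - 1)) := by
        refine ENNReal.tsum_le_tsum fun k => ?_
        refine (measure_exists_occupation_ge_le hW.isPreBrownian3 hcont ht0
          (by positivity : 0 < ε / 4 ^ k) (by positivity : 0 < a k)).trans_eq ?_
        have h16 : (16 : ℝ) ^ k = 4 ^ k * 4 ^ k := by rw [← mul_pow]; norm_num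
        have h8 : (8 : ℝ) ^ k = 4 ^ k * 2 ^ k := by rw [← mul_pow]; norm_num
        have h4 : (4 : ℝ) ^ k = 2 ^ k * 2 ^ k := by rw [← mul_pow]; norm_num
        have e1 : a k / (192 * (ε / 4 ^ k) ^ 2) = b / (3072 * ε) * t * 2 ^ k := by
          rw [ha]
          simp only
          rw [h8, h4]
          field_simp
          norm_num
        have e2 : t / (3 * (ε / 4 ^ k) ^ 2) = t / (3 * ε ^ 2) * 16 ^ k := by
          rw [h16]
          field_simp
        rw [e1, e2]
    _ ≤ ENNReal.ofReal (4 * (t / (3 * ε ^ 2)) * Real.exp (-(b / (3072 * ε) * t))) :=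
        tsum_tail_le hu (by positivity)
    _ ≤ _ := by
        refine ENNReal.ofReal_le_ofReal (mul_le_mul_of_nonneg_right ?_ (Real.exp_pos _).le)
        rw [div_mul_eq_mul_div, mul_div_assoc', div_le_div_iff₀ (by positivity) (by positivity)]
        have : 0 ≤ t * ε ^ 2 := by positivity
        linarith

end Main

/-- The prefactor contributes `(log C + log t) / t`, which vanishes in the limit. -/
lemma limsup_log_le_of_exponential_bound {p : ℝ → ℝ≥0∞} {C c : ℝ} (hC : 0 < C)
    (hp : ∀ᶠ t in atTop, p t ≤ ENNReal.ofReal (C * t * Real.exp (-(c * t)))) :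
    limsup (fun t : ℝ => ((1 / t : ℝ) : EReal) * ENNReal.log (p t)) atTop ≤ ((-c : ℝ) : EReal) := by
  have hlim : Tendsto (fun t : ℝ => Real.log C / t + Real.log t / t - c) atTop (𝓝 (-c)) := by
    have h1 : Tendsto (fun t : ℝ => Real.log C / t) atTop (𝓝 0) :=
      tendsto_const_nhds.div_atTop tendsto_id
    have h2 : Tendsto (fun t : ℝ => Real.log t / t) atTop (𝓝 0) :=
      Real.isLittleO_log_id_atTop.tendsto_div_nhds_zero
    simpa using (h1.add h2).sub_const c
  have hlim' := (continuous_coe_real_ereal.tendsto (-c)).comp hlim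
  rw [← hlim'.limsup_eq]
  refine limsup_le_limsup ?_
  filter_upwards [hp, eventually_gt_atTop 0] with t hpt ht
  have hy : 0 < C * t * Real.exp (-(c * t)) := by positivity
  have h1 : ENNReal.log (p t) ≤ ((Real.log C + Real.log t - c * t : ℝ) : EReal) := by
    refine (ENNReal.log_le_log hpt).trans_eq ?_
    rw [ENNReal.log_ofReal_of_pos hy, Real.log_mul (by positivity) (by positivity),
      Real.log_mul hC.ne' ht.ne', Real.log_exp]
    rfl
  refine (mul_le_mul_of_nonneg_left h1 (by exact_mod_cast (by positivity : 0 ≤ 1 / t))).trans_eq ?_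
  rw [← EReal.coe_mul]
  simp only [Function.comp_apply]
  congr 1
  field_simp

theorem theorem1p3 {Ω : Type*} [MeasurableSpace Ω] (P : Measure Ω) [IsProbabilityMeasure P]
    (W : ℝ≥0 → Ω → EuclideanSpace ℝ (Fin 3)) (hW : IsBrownianMotion3 W P)
    (b : ℝ) (hb : 0 < b) :
    Tendsto
      (fun δ : ℝ =>
        limsup
          (fun t : ℝ => ((1 / t : ℝ) : EReal) *
            ENNReal.log (P {ω | ENNReal.ofReal b ≤ coulombOscillation (fun s => W s ω) t δ}))
          atTop)
      (𝓝[>] 0) (𝓝 ⊥) := by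
  rw [EReal.tendsto_nhds_bot_iff_real]
  intro x
  -- Chosen so that the rate `b / (3072 * ε)` is `|x| + 1`, whence the limsup is below `x`.
  set ε : ℝ := b / (3072 * (|x| + 1)) with hε
  have hε0 : 0 < ε := by positivity
  have hrate : b / (3072 * ε) = |x| + 1 := by rw [hε]; field_simp
  have hδ : ∀ᶠ δ : ℝ in 𝓝[>] 0, δ < b / 2 * ε ^ 2 :=
    nhdsWithin_le_nhds (eventually_lt_nhds (by positivity))
  filter_upwards [hδ, self_mem_nhdsWithin] with δ h1 h2
  refine (limsup_log_le_of_exponential_bound (C := 2 / ε ^ 2) (c := |x| + 1) (by positivity)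
    ?_).trans_lt ?_
  · filter_upwards [eventually_ge_atTop (12288 * ε / b)] with t ht
    rw [← hrate]
    exact measure_coulombOscillation_ge_le hW hb hε0 (le_of_lt h2)
      ((div_lt_iff₀ (by positivity)).2 h1) ht
  · exact_mod_cast (by linarith [neg_abs_le x] : -(|x| + 1) < x)
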